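/- Let $K$ be a field and let $A$ be a linearly ordered set (an alphabet, not necessarily finite). A nonempty word in $A$ is a *Lyndon–Shirshov word* if it is lexicographically strictly smaller than each of its proper cyclic permutations. The *left-greedy bracketing* $\lfloor w\rfloor$ of a nonempty word $w$ is defined as follows. For a letter $\alpha$, an $\alpha$-*simple word* is a word of the form $\alpha^n\chi$ with $n\ge 0$ and $\chi$ a single letter different from $\alpha$. If a word of length at least two with first letter $\alpha$ can be written as a product of $\alpha$-simple words, this expression is unique and is called its *simple partition*. Its simple factors are regarded as the letters of a shorter word over the alphabet of words in $A$ (two letters being equal if they are equal as words). Repeat this procedure. The word $w$ *fully partitions* if one arrives in this way at a word with a single letter (which is then $w$ itself). In this case $\lfloor w\rfloor$ is the formal Lie bracket expression obtained by setting $\lfloor a\rfloor=a$ for $a\in A$ and, for every simple factor $\alpha^n\chi$ that occurs in the procedure, $$\lfloor \alpha^n\chi\rfloor=\bigl[\lfloor\alpha\rfloor,\bigl[\lfloor\alpha\rfloor,\ldots\bigl[\lfloor\alpha\rfloor,\lfloor\chi\rfloor\bigr]\cdots\bigr]\bigr]\qquad (n\text{ copies of }\lfloor\alpha\rfloor).$$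 Then every Lyndon–Shirshov word $w$ in $A$ fully partitions, and the elements $\lfloor w\rfloor$, indexed by the Lyndon–Shirshov words $w$ in $A$, form a linear basis of the free Lie algebra over $K$ on $A$. -/

import Mathlib

/-- A word (a list of letters) is a Lyndon-Shirshov word if it is nonempty and lexicographically
strictly smaller than each of its proper cyclic permutations. -/
def IsLyndonShirshov {A : Type*} [LinearOrder A] (w : List A) : Prop :=
  w ≠ [] ∧ ∀ k, 0 < k → k < w.length → w < w.rotate k

namespace LeftGreedy

/-- The word spelled by a bracket expression: erase the brackets, keep the letters in order. -/
def word {A : Type*} : FreeMagma A → List A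
  | FreeMagma.of x => [x]
  | FreeMagma.mul s t => word s ++ word t

/-- The bracketing of the simple word `α ^ n χ`, given bracket expressions for `α` and `χ`:
`[α, [α, … [α, χ] … ]]`, with `n` copies of `α`. -/
def simpleBracket {A : Type*} (α : FreeMagma A) (n : ℕ) (χ : FreeMagma A) : FreeMagma A :=
  (fun t => FreeMagma.mul α t)^[n] χ

/-- The partition of a word of (bracketed) words into `α`-simple words, if there is one.
The entries of the list are the letters of the word of words, two of them being the same letter
if they are the same word. An `α`-simple word `α ^ n χ` with `χ ≠ α` is recorded as `(n, χ)`.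
The value is `none` if there is no such partition, that is, if the last letter is `α`. -/
def simplePartition {A : Type*} [DecidableEq A] (α : FreeMagma A) :
    List (FreeMagma A) → Option (List (ℕ × FreeMagma A))
  | [] => some []
  | x :: l =>
    if word x = word α then
      match simplePartition α l with
      | some ((n, χ) :: p) => some ((n + 1, χ) :: p)
      | _ => none
    else
      match simplePartition α l with
      | some p => some ((0, x) :: p)
      | none => none

theorem length_le_of_simplePartition {A : Type*} [DecidableEq A] (α : FreeMagma A) :
    ∀ (l : List (FreeMagma A)) (p : List (ℕ × FreeMagma A)),
      simplePartition α l = some p → p.length ≤ l.length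
  | [], p, h => by
    simp only [simplePartition, Option.some.injEq] at h
    simp [← h]
  | x :: l, p, h => by
    have ih := length_le_of_simplePartition α l
    simp only [simplePartition] at h
    split at h <;> split at h
    · rename_i n χ q hq
      simp only [Option.some.injEq] at h
      have := ih _ hq
      simp only [← h, List.length_cons] at this ⊢
      omega
    · simp at h
    · rename_i q hq
      simp only [Option.some.injEq] at h
      have := ih _ hq
      simp only [← h, List.length_cons]
      omega
    · simp at h

theorem length_lt_of_simplePartition {A : Type*} [DecidableEq A] (α : FreeMagma A)
    (l : List (FreeMagma A)) (p : List (ℕ × FreeMagma A))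
    (h : simplePartition α (α :: l) = some p) : p.length < (α :: l).length := by
  simp only [simplePartition, if_true] at h
  split at h
  · rename_i n χ q hq
    simp only [Option.some.injEq] at h
    have := length_le_of_simplePartition α l _ hq
    simp only [← h, List.length_cons] at this ⊢
    omega
  · simp at h

/-- The left-greedy bracketing of a word of (bracketed) words. A word of one letter is its own
bracketing. A longer word is partitioned into simple words with respect to its first letter, each
simple word is bracketed and becomes a single letter, and the procedure is repeated.
The value is `none` if the word does not fully partition. -/
def bracketWord {A : Type*} [DecidableEq A] : List (FreeMagma A) → Option (FreeMagma A)
  | [] => none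
  | [t] => some t
  | α :: β :: l =>
    match _h : simplePartition α (α :: β :: l) with
    | some p => bracketWord (p.map fun q => simpleBracket α q.1 q.2)
    | none => none
  termination_by l => l.length
  decreasing_by
    rw [List.length_map]
    exact length_lt_of_simplePartition α (β :: l) p _h

/-- The left-greedy bracketing of a word, as a formal bracket expression; it is `none` if the word
does not fully partition. -/
def leftGreedy {A : Type*} [DecidableEq A] (w : List A) : Option (FreeMagma A) :=
  bracketWord (w.map FreeMagma.of)

/-- The element of the free Lie algebra denoted by a bracket expression. -/
noncomputable def toFreeLie (K : Type*) [CommRing K] {A : Type*} :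
    FreeMagma A → FreeLieAlgebra K A
  | FreeMagma.of x => FreeLieAlgebra.of K x
  | FreeMagma.mul s t => ⁅toFreeLie K s, toFreeLie K t⁆

end LeftGreedy

/-! ### Lexicographic comparison of concatenations. -/

section LexicographicOrder

variable {A : Type*} [LinearOrder A]

/-! Independence comes from leading words, spanning from Lazard elimination. Throughout, the letters
of a word of words form a prefix-free set, so flattened words compare by the first letter in which
they differ. In a Lyndon word over such letters every letter other than the first letter `α` is
larger than `α`, and the last letter is not `α`; hence the simple partition exists, and the simple
factors are again prefix-free letters spelling the same word. This yields full partition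
(`exists_bracketWord_eq_some`). Each bracketing step has `α < χ` with `α` no prefix of `χ`, so `αt <
tα` for `t = α ^ n χ`, and the commutator of polynomials with least words `α` and `t` has least word
`αt`. So the bracketing of `w` maps to `w` plus larger words of the same length in the free
associative algebra, which gives independence. For spanning, work in degree at most `d` over a
finite alphabet and eliminate its least letter `α`: every bracket is a combination of `α` and
brackets in the letters `[α, …, [α, χ]]`. Left-greedy brackets over the new alphabet are left-greedy
over the old one (`lyndonBrackets_simpleLetters_subset`), because elimination reverses one partition
step. Each elimination trades one letter for finitely many of higher degree, so the process
terminates. -/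

theorem List.append_lt_append_left_iff {z x y : List A} : z ++ x < z ++ y ↔ x < y := by
  induction z with
  | nil => rfl
  | cons a z ih => simpa [List.cons_lt_cons_iff] using ih

/-- The comparison is decided at a position inside both words, so whatever follows is irrelevant. -/
theorem List.append_lt_append_of_not_prefix :
    ∀ {x y : List A}, x < y → ¬ x <+: y → ∀ s t : List A, x ++ s < y ++ t
  | [], _, _, hp, _, _ => absurd (List.nil_prefix) hp
  | _ :: _, [], h, _, _, _ => absurd h (List.not_lt_nil _)
  | a :: x, b :: y, h, hp, s, t => by
    rw [List.cons_lt_cons_iff] at h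
    simp only [List.cons_append, List.cons_lt_cons_iff]
    rcases h with h | ⟨rfl, h⟩
    · exact Or.inl h
    · refine Or.inr ⟨rfl, List.append_lt_append_of_not_prefix h (fun h' => hp ?_) s t⟩
      simpa using h'

theorem List.not_prefix_of_lt_of_length_le {x y : List A} (h : x < y)
    (hl : y.length ≤ x.length) : ¬ x <+: y := fun hp =>
  h.ne (hp.eq_of_length_le hl)

theorem List.lt_append_of_ne_nil {x y : List A} (hy : y ≠ []) : x < x ++ y := by
  obtain ⟨b, y, rfl⟩ := List.exists_cons_of_ne_nil hy
  simpa using List.append_lt_append_left_iff (z := x).2 (List.nil_lt_cons b y)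

end LexicographicOrder

/-! ### Lyndon words, by rotations and by suffixes. -/

section Lyndon

variable {A : Type*} [LinearOrder A]

theorem IsLyndonShirshov.append_lt_append_swap {x y : List A} (h : IsLyndonShirshov (x ++ y))
    (hx : x ≠ []) (hy : y ≠ []) : x ++ y < y ++ x := by
  have := h.2 x.length (List.length_pos_iff.2 hx)
    (by simpa using List.length_pos_iff.2 hy)
  rwa [List.rotate_append_length_eq] at this

/-- The description of Lyndon-Shirshov words by suffixes: the word is smaller than each of its
nonempty proper suffixes. -/
def IsSuffixMinimal (w : List A) : Prop :=
  w ≠ [] ∧ ∀ x y, x ≠ [] → y ≠ [] → w = x ++ y → w < y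

theorem IsSuffixMinimal.singleton (a : A) : IsSuffixMinimal [a] := by
  refine ⟨by simp, fun x y hx hy h => ?_⟩
  have := congrArg List.length h
  have h1 := List.length_pos_iff.2 hx
  have h2 := List.length_pos_iff.2 hy
  simp only [List.length_append, List.length_cons, List.length_nil] at this
  omega

theorem IsSuffixMinimal.not_prefix {w x y : List A} (hw : IsSuffixMinimal w) (hx : x ≠ [])
    (hy : y ≠ []) (h : w = x ++ y) : ¬ w <+: y :=
  List.not_prefix_of_lt_of_length_le (hw.2 x y hx hy h) (by simp [h])

theorem IsSuffixMinimal.isLyndonShirshov {w : List A} (hw : IsSuffixMinimal w) :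
    IsLyndonShirshov w := by
  refine ⟨hw.1, fun k hk hkw => ?_⟩
  have hx : w.take k ≠ [] := by
    intro h; rcases List.take_eq_nil_iff.1 h with h | h
    · omega
    · exact hw.1 h
  have hy : w.drop k ≠ [] := by
    intro h; have := List.drop_eq_nil_iff.1 h; omega
  have e : w = w.take k ++ w.drop k := (List.take_append_drop k w).symm
  rw [List.rotate_eq_drop_append_take hkw.le]
  simpa using List.append_lt_append_of_not_prefix (hw.2 _ _ hx hy e) (hw.not_prefix hx hy e)
    [] (w.take k)

/-- First `uv < v`: if `v = ur`, cancel `u` and use `v < r`. A suffix starting inside `u` already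
beats `u` at some position; one starting inside `v` is at least `v`. -/
theorem IsSuffixMinimal.append {u v : List A} (hu : IsSuffixMinimal u) (hv : IsSuffixMinimal v)
    (huv : u < v) : IsSuffixMinimal (u ++ v) := by
  have key : u ++ v < v := by
    by_cases hp : u <+: v
    · obtain ⟨r, rfl⟩ := hp
      have hr : r ≠ [] := by rintro rfl; simp at huv
      exact List.append_lt_append_left_iff.2 (hv.2 u r hu.1 hr rfl)
    · simpa using List.append_lt_append_of_not_prefix huv hp v []
  refine ⟨by simp [hu.1], fun x y hx hy h => ?_⟩
  rcases List.append_eq_append_iff.1 h with ⟨r, rfl, rfl⟩ | ⟨r, rfl, rfl⟩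
  · by_cases hr : r = []
    · subst hr; simpa using key
    · exact key.trans (hv.2 r y hr hy rfl)
  · by_cases hr : r = []
    · subst hr; simpa using key
    · exact List.append_lt_append_of_not_prefix (hu.2 x r hx hr rfl) (hu.not_prefix hx hr rfl) _ _

/-- The two rotations that split off an outer `u` force both `xu < ux` and `uxu < xuu`, which
conflict. -/
theorem not_isLyndonShirshov_append_append (u x : List A) (hu : u ≠ []) :
    ¬ IsLyndonShirshov (u ++ x ++ u) := by
  intro h
  have h1 := h.append_lt_append_swap (by simp [hu]) hu
  rw [List.append_assoc, List.append_lt_append_left_iff] at h1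
  rw [List.append_assoc] at h
  have h2 := h.append_lt_append_swap hu (by simp [hu])
  have h3 := List.append_lt_append_of_not_prefix h1
    (List.not_prefix_of_lt_of_length_le h1 (by simp [add_comm])) u u
  simp only [List.append_assoc] at h2 h3
  exact lt_asymm h2 h3

end Lyndon

/-! ### Prefix-free alphabets and simple partitions. -/

namespace LeftGreedy

section Words

variable {A : Type*}

theorem word_ne_nil : ∀ t : FreeMagma A, word t ≠ []
  | FreeMagma.of x => by simp [word]
  | FreeMagma.mul s t => by simp [word, word_ne_nil s]

theorem simpleBracket_zero (α χ : FreeMagma A) : simpleBracket α 0 χ = χ := rfl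

theorem simpleBracket_succ (α : FreeMagma A) (n : ℕ) (χ : FreeMagma A) :
    simpleBracket α (n + 1) χ = FreeMagma.mul α (simpleBracket α n χ) :=
  Function.iterate_succ_apply' _ _ _

theorem word_simpleBracket_succ (α : FreeMagma A) (n : ℕ) (χ : FreeMagma A) :
    word (simpleBracket α (n + 1) χ) = word α ++ word (simpleBracket α n χ) := by
  rw [simpleBracket_succ, word]

theorem flatMap_word_ne_nil {l : List (FreeMagma A)} (hl : l ≠ []) : l.flatMap word ≠ [] := by
  obtain ⟨x, l, rfl⟩ := List.exists_cons_of_ne_nil hl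
  simp [word_ne_nil]

theorem flatMap_word_map_of (w : List A) : (w.map FreeMagma.of).flatMap word = w := by
  simp [List.flatMap_map, word]

/-- A set of bracketed words no two of which have words that are prefixes of each other. -/
def PrefixFree (S : Set (FreeMagma A)) : Prop :=
  ∀ x ∈ S, ∀ y ∈ S, word x <+: word y → x = y

/-- Cancel common copies of `α`; a mismatch in their number would make `α` prefix-comparable with a
letter other than `α`. -/
theorem PrefixFree.simpleBracket {S : Set (FreeMagma A)} (hS : PrefixFree S) {α : FreeMagma A}
    (hα : α ∈ S) {T : Set (FreeMagma A)}
    (hT : ∀ t ∈ T, ∃ n, ∃ χ ∈ S, χ ≠ α ∧ t = LeftGreedy.simpleBracket α n χ) :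
    PrefixFree T := by
  have key : ∀ n m : ℕ, ∀ χ ∈ S, χ ≠ α → ∀ ψ ∈ S, ψ ≠ α →
      word (LeftGreedy.simpleBracket α n χ) <+: word (LeftGreedy.simpleBracket α m ψ) →
      LeftGreedy.simpleBracket α n χ = LeftGreedy.simpleBracket α m ψ := by
    intro n
    induction n with
    | zero =>
      intro m χ hχ hχα ψ hψ hψα h
      cases m with
      | zero => exact hS χ hχ ψ hψ h
      | succ m =>
        rw [word_simpleBracket_succ] at h
        rcases List.prefix_or_prefix_of_prefix h (List.prefix_append _ _) with h' | h'
        · exact absurd (hS χ hχ α hα h') hχα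
        · exact absurd (hS α hα χ hχ h').symm hχα
    | succ n ih =>
      intro m χ hχ hχα ψ hψ hψα h
      rw [word_simpleBracket_succ] at h
      cases m with
      | zero =>
        exact absurd (hS α hα ψ hψ ((List.prefix_append _ _).trans h)).symm hψα
      | succ m =>
        rw [word_simpleBracket_succ, List.prefix_append_right_inj] at h
        rw [simpleBracket_succ, simpleBracket_succ, ih m χ hχ hχα ψ hψ hψα h]
  intro x hx y hy hxy
  obtain ⟨n, χ, hχ, hχα, rfl⟩ := hT x hx
  obtain ⟨m, ψ, hψ, hψα, rfl⟩ := hT y hy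
  exact key n m χ hχ hχα ψ hψ hψα hxy

/-- The word of words whose partition into `α`-simple words is `p`. -/
def ofPartition (α : FreeMagma A) (p : List (ℕ × FreeMagma A)) : List (FreeMagma A) :=
  p.flatMap fun q => List.replicate q.1 α ++ [q.2]

theorem ofPartition_nil (α : FreeMagma A) : ofPartition α [] = [] := rfl

theorem ofPartition_cons_zero (α χ : FreeMagma A) (p : List (ℕ × FreeMagma A)) :
    ofPartition α ((0, χ) :: p) = χ :: ofPartition α p := by
  simp [ofPartition]

theorem ofPartition_cons_succ (α χ : FreeMagma A) (n : ℕ) (p : List (ℕ × FreeMagma A)) :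
    ofPartition α ((n + 1, χ) :: p) = α :: ofPartition α ((n, χ) :: p) := by
  simp [ofPartition, List.replicate_succ]

theorem ofPartition_eq_nil_iff {α : FreeMagma A} {p : List (ℕ × FreeMagma A)} :
    ofPartition α p = [] ↔ p = [] := by
  cases p <;> simp [ofPartition]

theorem flatMap_word_ofPartition (α : FreeMagma A) : ∀ p : List (ℕ × FreeMagma A),
    (ofPartition α p).flatMap word = (p.map fun q => simpleBracket α q.1 q.2).flatMap word
  | [] => rfl
  | (0, χ) :: p => by
    simp [ofPartition_cons_zero, flatMap_word_ofPartition α p, simpleBracket_zero]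
  | (n + 1, χ) :: p => by
    have := flatMap_word_ofPartition α ((n, χ) :: p)
    simp only [List.map_cons, List.flatMap_cons] at this
    simp [ofPartition_cons_succ, word_simpleBracket_succ, this]

theorem exists_eq_ofPartition (α : FreeMagma A) : ∀ l : List (FreeMagma A),
    (∀ h : l ≠ [], l.getLast h ≠ α) →
      ∃ p, l = ofPartition α p ∧ ∀ q ∈ p, q.2 ∈ l ∧ q.2 ≠ α
  | [], _ => ⟨[], rfl, by simp⟩
  | x :: l, h => by
    have hl : ∀ h : l ≠ [], l.getLast h ≠ α := fun hl => by
      have := h (by simp)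
      rwa [List.getLast_cons hl] at this
    obtain ⟨p, rfl, hp⟩ := exists_eq_ofPartition α l hl
    by_cases hx : x = α
    · subst hx
      match p with
      | [] => exact absurd rfl (h (by simp))
      | (n, χ) :: p =>
        refine ⟨(n + 1, χ) :: p, (ofPartition_cons_succ _ _ _ _).symm, fun q hq => ?_⟩
        rcases List.mem_cons.1 hq with rfl | hq
        · exact ⟨List.mem_cons_of_mem _ (hp (n, χ) (by simp)).1, (hp (n, χ) (by simp)).2⟩
        · exact ⟨List.mem_cons_of_mem _ (hp q (by simp [hq])).1, (hp q (by simp [hq])).2⟩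
    · refine ⟨(0, x) :: p, (ofPartition_cons_zero _ _ _).symm, fun q hq => ?_⟩
      rcases List.mem_cons.1 hq with rfl | hq
      · exact ⟨by simp, hx⟩
      · exact ⟨List.mem_cons_of_mem _ (hp q hq).1, (hp q hq).2⟩

variable [DecidableEq A]

theorem simplePartition_ofPartition (α : FreeMagma A) : ∀ p : List (ℕ × FreeMagma A),
    (∀ q ∈ p, word q.2 ≠ word α) → simplePartition α (ofPartition α p) = some p
  | [], _ => rfl
  | (0, χ) :: p, h => by
    rw [ofPartition_cons_zero, simplePartition, if_neg (h (0, χ) (by simp)),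
      simplePartition_ofPartition α p fun q hq => h q (by simp [hq])]
  | (n + 1, χ) :: p, h => by
    have ih := simplePartition_ofPartition α ((n, χ) :: p) fun q hq => by
      rcases List.mem_cons.1 hq with rfl | hq
      · exact h (n + 1, χ) (by simp)
      · exact h q (by simp [hq])
    rw [ofPartition_cons_succ, simplePartition, if_pos rfl, ih]

theorem bracketWord_ofPartition (α χ : FreeMagma A) (n : ℕ) (p : List (ℕ × FreeMagma A))
    (h : ∀ q ∈ (n + 1, χ) :: p, word q.2 ≠ word α) :
    bracketWord (ofPartition α ((n + 1, χ) :: p)) =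
      bracketWord (((n + 1, χ) :: p).map fun q => simpleBracket α q.1 q.2) := by
  have e := simplePartition_ofPartition α _ h
  have hl : ofPartition α ((n, χ) :: p) ≠ [] := by simp [ofPartition_eq_nil_iff]
  rw [ofPartition_cons_succ] at e ⊢
  -- `bracketWord` unfolds only when two leading letters are visible; the second exists since `χ` is
  -- still to come after `α`.
  obtain ⟨β, l, hβ⟩ := List.exists_cons_of_ne_nil hl
  rw [hβ] at e ⊢
  rw [bracketWord]
  split
  · rename_i p' hp'
    rw [e, Option.some.injEq] at hp'
    rw [hp']
  · rename_i hp'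
    rw [e] at hp'
    cases hp'

end Words

/-! ### Lyndon words fully partition. -/

section Order

variable {A : Type*} [LinearOrder A]

/-- Otherwise the rotation starting at `χ` would be smaller, by prefix-freeness. -/
theorem word_lt_of_isLyndonShirshov {α χ : FreeMagma A} {l : List (FreeMagma A)}
    (h : IsLyndonShirshov ((α :: l).flatMap word))
    (hl : PrefixFree {t | t ∈ α :: l}) (hχ : χ ∈ l) (hne : χ ≠ α) : word α < word χ := by
  obtain ⟨l₁, l₂, rfl⟩ := List.append_of_mem hχ
  have e : (α :: (l₁ ++ χ :: l₂)).flatMap word =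
      (α :: l₁).flatMap word ++ (χ :: l₂).flatMap word := by simp
  rw [e] at h
  have h1 := h.append_lt_append_swap (flatMap_word_ne_nil (by simp)) (flatMap_word_ne_nil (by simp))
  simp only [List.flatMap_cons, List.append_assoc] at h1
  have hα' : α ∈ {t | t ∈ α :: (l₁ ++ χ :: l₂)} := by simp
  have hχ' : χ ∈ {t | t ∈ α :: (l₁ ++ χ :: l₂)} := by simp
  rcases lt_trichotomy (word α) (word χ) with h2 | h2 | h2
  · exact h2
  · exact absurd (hl χ hχ' α hα' (h2 ▸ List.prefix_rfl)) hne
  · exact absurd (List.append_lt_append_of_not_prefix h2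
      (fun hp => hne (hl χ hχ' α hα' hp)) _ _) (lt_asymm h1)

theorem getLast_ne_of_isLyndonShirshov {α : FreeMagma A} {l : List (FreeMagma A)}
    (h : IsLyndonShirshov ((α :: l).flatMap word)) (hl : l ≠ []) : l.getLast hl ≠ α := by
  intro e
  rw [← List.dropLast_append_getLast hl, e] at h
  exact not_isLyndonShirshov_append_append (word α) (l.dropLast.flatMap word) (word_ne_nil α)
    (by simpa using h)

/-- Every property of bracketed words that is inherited by the brackets `[α, [α, … [α, χ] … ]]`
formed from `α` and `χ` with `α < χ` is inherited by the left-greedy bracketing. -/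
theorem exists_bracketWord_eq_some (P : FreeMagma A → Prop)
    (hP : ∀ (α χ : FreeMagma A) (n : ℕ), P α → P χ → word α < word χ →
      ¬ word α <+: word χ → P (simpleBracket α n χ)) :
    ∀ (N : ℕ) (l : List (FreeMagma A)), l.length ≤ N → IsLyndonShirshov (l.flatMap word) →
      PrefixFree {t | t ∈ l} → (∀ t ∈ l, P t) →
      ∃ t, bracketWord l = some t ∧ word t = l.flatMap word ∧ P t := by
  intro N
  induction N with
  | zero =>
    intro l hN h
    have : l = [] := List.length_eq_zero_iff.1 (Nat.le_zero.1 hN)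
    subst this
    exact absurd rfl h.1
  | succ N ih =>
    intro l hN h hl hPl
    match l with
    | [] => exact absurd rfl h.1
    | [t] => exact ⟨t, by rw [bracketWord], by simp, hPl t (by simp)⟩
    | α :: β :: l =>
      have hlast : ∀ hn : α :: β :: l ≠ [], (α :: β :: l).getLast hn ≠ α := fun _ => by
        rw [List.getLast_cons (by simp)]
        exact getLast_ne_of_isLyndonShirshov h (by simp)
      obtain ⟨p, hlp, hp⟩ := exists_eq_ofPartition α _ hlast
      have hpref : ∀ q ∈ p, ¬ word α <+: word q.2 := fun q hq hpr =>
        (hp q hq).2 (hl _ (by simp) _ (hp q hq).1 hpr).symm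
      match p, hlp, hp, hpref with
      | [], hlp, _, _ => exact absurd hlp (by simp [ofPartition_nil])
      -- Impossible: the word starts with `α`, so its first factor contains a copy of `α`.
      | (0, χ) :: p, hlp, hp, _ =>
        rw [ofPartition_cons_zero] at hlp
        injection hlp with h1 _
        exact absurd h1.symm (hp (0, χ) (by simp)).2
      | (n + 1, χ) :: p, hlp, hp, hpref =>
        have e := bracketWord_ofPartition α χ n p fun q hq he =>
          hpref q hq (he ▸ List.prefix_rfl)
        rw [← hlp] at e
        have ew := flatMap_word_ofPartition α ((n + 1, χ) :: p)
        rw [← hlp] at ew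
        rw [e, ew]
        apply ih
        -- Dropping the leading `α` leaves at most `N` letters but the same number of simple
        -- factors.
        · have := length_le_of_simplePartition α (ofPartition α ((n, χ) :: p)) _
            (simplePartition_ofPartition α _ fun q hq he => by
              rcases List.mem_cons.1 hq with rfl | hq
              · exact hpref (n + 1, χ) (by simp) (he ▸ List.prefix_rfl)
              · exact hpref q (by simp [hq]) (he ▸ List.prefix_rfl))
          rw [hlp, ofPartition_cons_succ] at hN
          simp only [List.length_map, List.length_cons] at this hN ⊢
          omega
        · rwa [← ew]
        · refine hl.simpleBracket (α := α) (by simp) fun t ht => ?_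
          obtain ⟨q, hq, rfl⟩ := List.mem_map.1 ht
          exact ⟨q.1, q.2, (hp q hq).1, (hp q hq).2, rfl⟩
        · intro t ht
          obtain ⟨q, hq, rfl⟩ := List.mem_map.1 ht
          have hmem : q.2 ∈ β :: l :=
            (List.mem_cons.1 (hp q hq).1).resolve_left (hp q hq).2
          exact hP _ _ _ (hPl α (by simp)) (hPl _ (hp q hq).1)
            (word_lt_of_isLyndonShirshov h hl hmem (hp q hq).2) (hpref q hq)

theorem exists_leftGreedy_eq_some (P : FreeMagma A → Prop) (hof : ∀ x, P (FreeMagma.of x))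
    (hP : ∀ (α χ : FreeMagma A) (n : ℕ), P α → P χ → word α < word χ →
      ¬ word α <+: word χ → P (simpleBracket α n χ))
    {w : List A} (hw : IsLyndonShirshov w) :
    ∃ t, leftGreedy w = some t ∧ word t = w ∧ P t := by
  have e := flatMap_word_map_of w
  have := exists_bracketWord_eq_some P hP _ (w.map FreeMagma.of) le_rfl (by rwa [e]) ?_ ?_
  · rwa [e] at this
  · intro x hx y hy hxy
    obtain ⟨a, -, rfl⟩ := List.mem_map.1 hx
    obtain ⟨b, -, rfl⟩ := List.mem_map.1 hy
    have : a = b := by simpa [word] using hxy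
    rw [this]
  · intro t ht
    obtain ⟨a, -, rfl⟩ := List.mem_map.1 ht
    exact hof a

end Order

end LeftGreedy

/-! ### Leading words and linear independence. -/

namespace LeftGreedy

section LeadingWord

attribute [local instance 100] LieRing.ofAssociativeRing

variable (K : Type*) [Field K] {A : Type*}

/-- The canonical map from the free Lie algebra to the algebra of noncommutative polynomials. -/
noncomputable def toPolynomial : FreeLieAlgebra K A →ₗ⁅K⁆ MonoidAlgebra K (FreeMonoid A) :=
  FreeLieAlgebra.lift K fun x => MonoidAlgebra.of K (FreeMonoid A) (FreeMonoid.of x)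

variable [LinearOrder A]

/-- The monomials that have the length of `w` and are lexicographically larger than `w`. -/
def higherMonomials (w : List A) : Set (MonoidAlgebra K (FreeMonoid A)) :=
  {f | ∃ v : List A, v.length = w.length ∧ w < v ∧
    f = MonoidAlgebra.of K (FreeMonoid A) (FreeMonoid.ofList v)}

/-- `w` is the least word of the noncommutative polynomial `f`, with coefficient one, and
the other words of `f` have the same length. -/
def HasLeadingWord (f : MonoidAlgebra K (FreeMonoid A)) (w : List A) : Prop :=
  f - MonoidAlgebra.of K (FreeMonoid A) (FreeMonoid.ofList w) ∈
    Submodule.span K (higherMonomials K w)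

variable {K}

theorem span_higherMonomials_mono {u w : List A} (hl : u.length = w.length) (h : u ≤ w) :
    Submodule.span K (higherMonomials K w) ≤ Submodule.span K (higherMonomials K u) := by
  apply Submodule.span_mono
  rintro _ ⟨v, hv, hwv, rfl⟩
  exact ⟨v, hv.trans hl.symm, lt_of_le_of_lt h hwv, rfl⟩

theorem HasLeadingWord.mul {f g : MonoidAlgebra K (FreeMonoid A)} {u v : List A}
    (hf : HasLeadingWord K f u) (hg : HasLeadingWord K g v) :
    HasLeadingWord K (f * g) (u ++ v) := by
  have mulmem : ∀ S T : Set (MonoidAlgebra K (FreeMonoid A)), ∀ a ∈ Submodule.span K S,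
      ∀ b ∈ Submodule.span K T, (∀ x ∈ S, ∀ y ∈ T, x * y ∈ higherMonomials K (u ++ v)) →
      a * b ∈ Submodule.span K (higherMonomials K (u ++ v)) := by
    intro S T a ha b hb h
    have := Submodule.mul_mem_mul ha hb
    rw [Submodule.span_mul_span] at this
    refine Submodule.span_mono ?_ this
    rintro _ ⟨x, hx, y, hy, rfl⟩
    exact h x hx y hy
  have left : ∀ x ∈ higherMonomials K u, ∀ y : List A, y.length = v.length →
      x * MonoidAlgebra.of K (FreeMonoid A) (FreeMonoid.ofList y) ∈
        higherMonomials K (u ++ v) := by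
    rintro _ ⟨x, hx, hux, rfl⟩ y hy
    refine ⟨x ++ y, by simp [hx, hy], ?_, by rw [← map_mul]; rfl⟩
    exact List.append_lt_append_of_not_prefix hux
      (List.not_prefix_of_lt_of_length_le hux hx.le) _ _
  -- Each of the three terms has a factor with only words strictly above `u` or `v`; equal lengths
  -- keep the products above `uv`.
  have e : f * g - MonoidAlgebra.of K (FreeMonoid A) (FreeMonoid.ofList (u ++ v)) =
      (f - MonoidAlgebra.of K (FreeMonoid A) (FreeMonoid.ofList u)) *
        (g - MonoidAlgebra.of K (FreeMonoid A) (FreeMonoid.ofList v)) +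
      (f - MonoidAlgebra.of K (FreeMonoid A) (FreeMonoid.ofList u)) *
        MonoidAlgebra.of K (FreeMonoid A) (FreeMonoid.ofList v) +
      MonoidAlgebra.of K (FreeMonoid A) (FreeMonoid.ofList u) *
        (g - MonoidAlgebra.of K (FreeMonoid A) (FreeMonoid.ofList v)) := by
    rw [FreeMonoid.ofList_append, map_mul]
    noncomm_ring
  rw [HasLeadingWord, e]
  refine add_mem (add_mem ?_ ?_) ?_
  · refine mulmem _ _ _ hf _ hg fun x hx y hy => ?_
    obtain ⟨y, hy, -, rfl⟩ := hy
    exact left x hx y hy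
  · refine mulmem _ {MonoidAlgebra.of K (FreeMonoid A) (FreeMonoid.ofList v)} _ hf _
      (Submodule.mem_span_singleton_self _) fun x hx y hy => ?_
    rw [Set.mem_singleton_iff.1 hy]
    exact left x hx v rfl
  · refine mulmem {MonoidAlgebra.of K (FreeMonoid A) (FreeMonoid.ofList u)} _ _
      (Submodule.mem_span_singleton_self _) _ hg fun x hx y hy => ?_
    rw [Set.mem_singleton_iff.1 hx]
    obtain ⟨y, hy, hvy, rfl⟩ := hy
    exact ⟨u ++ y, by simp [hy], List.append_lt_append_left_iff.2 hvy, by rw [← map_mul]; rfl⟩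

/-- All words of `g * f` are at least `vu`, hence strictly above `uv`, so they do not disturb the
leading term of `f * g`. -/
theorem HasLeadingWord.lie {f g : MonoidAlgebra K (FreeMonoid A)} {u v : List A}
    (hf : HasLeadingWord K f u) (hg : HasLeadingWord K g v) (h : u ++ v < v ++ u) :
    HasLeadingWord K ⁅f, g⁆ (u ++ v) := by
  have h1 := hf.mul hg
  have h2 := hg.mul hf
  have hl : (u ++ v).length = (v ++ u).length := by simp [add_comm]
  have h3 : g * f ∈ Submodule.span K (higherMonomials K (u ++ v)) := by
    have := add_mem (span_higherMonomials_mono hl h.le h2)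
      (Submodule.subset_span (⟨v ++ u, hl.symm, h, rfl⟩ :
        MonoidAlgebra.of K (FreeMonoid A) (FreeMonoid.ofList (v ++ u)) ∈
          higherMonomials K (u ++ v)))
    rwa [sub_add_cancel] at this
  rw [HasLeadingWord, LieRing.of_associative_ring_bracket, sub_right_comm]
  exact sub_mem h1 h3

variable (K) in
theorem hasLeadingWord_of (x : A) :
    HasLeadingWord K (toPolynomial K (toFreeLie K (FreeMagma.of x))) (word (FreeMagma.of x)) := by
  rw [HasLeadingWord, toFreeLie, toPolynomial, FreeLieAlgebra.lift_of_apply, word,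
    FreeMonoid.ofList_singleton, sub_self]
  exact zero_mem _

theorem word_append_simpleBracket_lt {α χ : FreeMagma A} (h : word α < word χ)
    (hp : ¬ word α <+: word χ) (n : ℕ) :
    word α ++ word (simpleBracket α n χ) < word (simpleBracket α n χ) ++ word α := by
  induction n with
  | zero => exact List.append_lt_append_of_not_prefix h hp _ _
  | succ n ih =>
    rw [word_simpleBracket_succ, List.append_assoc]
    exact List.append_lt_append_left_iff.2 ih

theorem hasLeadingWord_simpleBracket {α χ : FreeMagma A} (n : ℕ)
    (hα : HasLeadingWord K (toPolynomial K (toFreeLie K α)) (word α))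
    (hχ : HasLeadingWord K (toPolynomial K (toFreeLie K χ)) (word χ))
    (h : word α < word χ) (hp : ¬ word α <+: word χ) :
    HasLeadingWord K (toPolynomial K (toFreeLie K (simpleBracket α n χ)))
      (word (simpleBracket α n χ)) := by
  induction n with
  | zero => exact hχ
  | succ n ih =>
    rw [word_simpleBracket_succ, simpleBracket_succ, toFreeLie, LieHom.map_lie]
    exact hα.lie ih (word_append_simpleBracket_lt h hp n)

theorem coeff_eq_zero_of_mem_span_higherMonomials {g : MonoidAlgebra K (FreeMonoid A)}
    {u w : List A} (hu : u ≤ w) (hg : g ∈ Submodule.span K (higherMonomials K w)) :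
    g.coeff (FreeMonoid.ofList u) = 0 := by
  induction hg using Submodule.span_induction with
  | mem x hx =>
    obtain ⟨v, -, hv, rfl⟩ := hx
    have : FreeMonoid.ofList v ≠ FreeMonoid.ofList u := fun h =>
      (hu.trans_lt hv).ne (FreeMonoid.ofList.injective h).symm
    simp [MonoidAlgebra.of_apply, this]
  | zero => simp
  | add x y _ _ hx hy => simp [hx, hy]
  | smul c x _ hx => simp [hx]

theorem HasLeadingWord.coeff_eq_one {f : MonoidAlgebra K (FreeMonoid A)} {w : List A}
    (hf : HasLeadingWord K f w) : f.coeff (FreeMonoid.ofList w) = 1 := by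
  simpa [MonoidAlgebra.of_apply, sub_eq_zero] using
    coeff_eq_zero_of_mem_span_higherMonomials le_rfl hf

theorem HasLeadingWord.coeff_eq_zero {f : MonoidAlgebra K (FreeMonoid A)} {w u : List A}
    (hf : HasLeadingWord K f w) (hu : u < w) : f.coeff (FreeMonoid.ofList u) = 0 := by
  have : FreeMonoid.ofList w ≠ FreeMonoid.ofList u := fun h =>
    hu.ne (FreeMonoid.ofList.injective h).symm
  simpa [MonoidAlgebra.of_apply, this] using
    coeff_eq_zero_of_mem_span_higherMonomials hu.le hf

/-- In a vanishing combination, the least word `m` with nonzero coefficient occurs in no other term,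
so its coefficient is zero after all. -/
theorem linearIndependent_of_hasLeadingWord {p : List A → Prop}
    (f : {w : List A // p w} → MonoidAlgebra K (FreeMonoid A))
    (hf : ∀ w, HasLeadingWord K (f w) w.1) : LinearIndependent K f := by
  classical
  rw [linearIndependent_iff']
  intro s c hc
  by_contra! hne
  obtain ⟨i, his, hi⟩ := hne
  obtain ⟨m, hm⟩ := Finset.exists_minimal (s := s.filter fun w => c w ≠ 0)
    ⟨i, Finset.mem_filter.2 ⟨his, hi⟩⟩
  obtain ⟨hms, hcm⟩ := Finset.mem_filter.1 hm.1
  apply hcm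
  have h := congrArg (fun g => MonoidAlgebra.coeff g (FreeMonoid.ofList m.1)) hc
  simp only [MonoidAlgebra.coeff_sum, MonoidAlgebra.coeff_smul, Finsupp.finsetSum_apply,
    Finsupp.smul_apply, MonoidAlgebra.coeff_zero, Finsupp.zero_apply] at h
  rw [Finset.sum_eq_single_of_mem m hms] at h
  · simpa [(hf m).coeff_eq_one] using h
  · intro w hw hwm
    by_cases hcw : c w = 0
    · simp [hcw]
    · have : m < w := lt_of_le_of_ne
        (le_of_not_gt fun hlt => absurd (hm.2 (Finset.mem_filter.2 ⟨hw, hcw⟩) hlt.le)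
          (not_le_of_gt hlt)) (Ne.symm hwm)
      rw [(hf w).coeff_eq_zero this, smul_zero]

theorem linearIndependent_of_hasLeadingWord_toPolynomial {p : List A → Prop}
    (f : {w : List A // p w} → FreeLieAlgebra K A)
    (hf : ∀ w, HasLeadingWord K (toPolynomial K (f w)) w.1) : LinearIndependent K f :=
  LinearIndependent.of_comp (toPolynomial K (A := A)).toLinearMap
    (linearIndependent_of_hasLeadingWord _ hf)

end LeadingWord

end LeftGreedy

/-! ### Lazard elimination, truncated by degree. -/

namespace LeftGreedy

section Elimination

variable {A : Type*}

/-- The bracket expressions formed from the elements of `S`. -/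
inductive Brackets (S : Set (FreeMagma A)) : FreeMagma A → Prop
  | of {t : FreeMagma A} : t ∈ S → Brackets S t
  | mul {s t : FreeMagma A} : Brackets S s → Brackets S t → Brackets S (FreeMagma.mul s t)

theorem brackets_range_of (t : FreeMagma A) :
    Brackets (FreeMagma.of '' {a | a ∈ word t}) t := by
  have key : ∀ u : FreeMagma A, ∀ T : Set A, (∀ a ∈ word u, a ∈ T) →
      Brackets (FreeMagma.of '' T) u := by
    intro u T
    induction u with
    | ih1 x => exact fun h => .of ⟨x, h x (by simp [word]), rfl⟩
    | ih2 s t hs ht =>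
      exact fun h => .mul (hs fun a ha => h a (List.mem_append_left _ ha))
        (ht fun a ha => h a (List.mem_append_right _ ha))
  exact key t _ fun a ha => ha

theorem lie_mem_of_mem_span {K L : Type*} [CommRing K] [LieRing L] [LieAlgebra K L] {X Y : Set L}
    {N : Submodule K L} (h : ∀ x ∈ X, ∀ y ∈ Y, ⁅x, y⁆ ∈ N) {x y : L}
    (hx : x ∈ Submodule.span K X) (hy : y ∈ Submodule.span K Y) : ⁅x, y⁆ ∈ N := by
  induction hx using Submodule.span_induction with
  | mem x hx =>
    induction hy using Submodule.span_induction with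
    | mem y hy => exact h x hx y hy
    | zero => simp
    | add y z _ _ hy hz => rw [lie_add]; exact add_mem hy hz
    | smul c y _ hy => rw [lie_smul]; exact N.smul_mem c hy
  | zero => simp
  | add x z _ _ hx hz => rw [add_lie]; exact add_mem hx hz
  | smul c x _ hx => rw [smul_lie]; exact N.smul_mem c hx

/-- The degree of a bracket expression. -/
def degree (t : FreeMagma A) : ℕ := (word t).length

theorem degree_pos (t : FreeMagma A) : 0 < degree t := List.length_pos_iff.2 (word_ne_nil t)

theorem degree_mul (s t : FreeMagma A) : degree (FreeMagma.mul s t) = degree s + degree t := by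
  simp [degree, word]

theorem degree_simpleBracket (α χ : FreeMagma A) (n : ℕ) :
    degree (simpleBracket α n χ) = n * degree α + degree χ := by
  induction n with
  | zero => simp [simpleBracket_zero]
  | succ n ih => rw [simpleBracket_succ, degree_mul, ih]; ring

/-- The letters `[α, [α, … [α, χ] … ]]` of degree at most `d`, where `χ` is a letter other
than `α`. -/
def simpleLetters (S : Set (FreeMagma A)) (α : FreeMagma A) (d : ℕ) : Set (FreeMagma A) :=
  {t | degree t ≤ d ∧ ∃ n, ∃ χ ∈ S, χ ≠ α ∧ t = simpleBracket α n χ}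

theorem simpleLetters_finite {S : Set (FreeMagma A)} (hS : S.Finite) (α : FreeMagma A) (d : ℕ) :
    (simpleLetters S α d).Finite := by
  refine (((Set.finite_Iic d).prod hS).image fun q => simpleBracket α q.1 q.2).subset ?_
  rintro _ ⟨hd, n, χ, hχ, -, rfl⟩
  refine ⟨(n, χ), ⟨?_, hχ⟩, rfl⟩
  rw [degree_simpleBracket] at hd
  have := degree_pos α
  have : n * 1 ≤ n * degree α := Nat.mul_le_mul_left n this
  rw [Set.mem_Iic]
  omega

/-- The relation along which the letters of an alphabet are replaced in Lazard elimination. -/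
def HigherDegree (d : ℕ) (s t : FreeMagma A) : Prop := degree t < degree s ∧ degree s ≤ d

theorem wellFounded_higherDegree (d : ℕ) : WellFounded (HigherDegree (A := A) d) :=
  Subrelation.wf (r := InvImage (· < ·) fun t => d - degree t)
    (fun {s t} (h : degree t < degree s ∧ degree s ≤ d) => by
      change d - degree s < d - degree t
      omega)
    (InvImage.wf _ wellFounded_lt)

variable (K : Type*) [Field K]

/-- The span of the bracket expressions of degree `n` that have the property `P`. -/
noncomputable def homogeneousSpan (P : FreeMagma A → Prop) (n : ℕ) : Submodule K (FreeLieAlgebra K A) :=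
  Submodule.span K (toFreeLie K '' {u | P u ∧ degree u = n})

variable {K}

theorem mem_homogeneousSpan {P : FreeMagma A → Prop} {t : FreeMagma A} {n : ℕ} (h : P t)
    (hn : degree t = n) : toFreeLie K t ∈ homogeneousSpan K P n :=
  Submodule.subset_span ⟨t, ⟨h, hn⟩, rfl⟩

theorem lie_mem_homogeneousSpan {S : Set (FreeMagma A)} {x y : FreeLieAlgebra K A} {m n k : ℕ}
    (hx : x ∈ homogeneousSpan K (Brackets S) m) (hy : y ∈ homogeneousSpan K (Brackets S) n)
    (hk : m + n = k) : ⁅x, y⁆ ∈ homogeneousSpan K (Brackets S) k := by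
  refine lie_mem_of_mem_span ?_ hx hy
  rintro _ ⟨u, ⟨hu, rfl⟩, rfl⟩ _ ⟨v, ⟨hv, rfl⟩, rfl⟩
  exact mem_homogeneousSpan (hu.mul hv) (by rw [degree_mul, hk])

/-- Bracketing with `α` is a derivation that sends a letter to the letter with one more copy of `α`;
the degree bound keeps that letter in the truncated alphabet. -/
theorem lie_letter_mem_homogeneousSpan {S : Set (FreeMagma A)} {α s : FreeMagma A} {d : ℕ}
    (hs : Brackets (simpleLetters S α d) s) (hd : degree α + degree s ≤ d) :
    ⁅toFreeLie K α, toFreeLie K s⁆ ∈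
      homogeneousSpan K (Brackets (simpleLetters S α d)) (degree α + degree s) := by
  induction hs with
  | of h =>
    obtain ⟨-, n, χ, hχ, hne, rfl⟩ := h
    refine mem_homogeneousSpan (t := FreeMagma.mul α (simpleBracket α n χ))
      (.of ⟨by rwa [degree_mul], n + 1, χ, hχ, hne, ?_⟩) (degree_mul _ _)
    rw [simpleBracket_succ]
  | @mul p q hp hq ihp ihq =>
    rw [degree_mul] at hd ⊢
    rw [toFreeLie, leibniz_lie]
    exact add_mem
      (lie_mem_homogeneousSpan (ihp (by omega)) (mem_homogeneousSpan hq rfl) (by omega))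
      (lie_mem_homogeneousSpan (mem_homogeneousSpan hp rfl) (ihq (by omega)) (by omega))

/-- Lazard elimination of the letter `α`, in degrees at most `d`. -/
theorem mem_homogeneousSpan_simpleLetters {S : Set (FreeMagma A)} {α t : FreeMagma A} {d : ℕ}
    (ht : Brackets S t) (hd : degree t ≤ d) :
    toFreeLie K t ∈
      homogeneousSpan K (fun u => u = α ∨ Brackets (simpleLetters S α d) u) (degree t) := by
  induction ht with
  | @of t h =>
    by_cases hα : t = α
    · exact mem_homogeneousSpan (Or.inl hα) rfl
    · exact mem_homogeneousSpan (Or.inr (.of ⟨hd, 0, t, h, hα, rfl⟩)) rfl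
  | @mul p q hp hq ihp ihq =>
    rw [degree_mul] at hd ⊢
    have hle : homogeneousSpan K (Brackets (simpleLetters S α d)) (degree p + degree q) ≤
        homogeneousSpan K (fun u => u = α ∨ Brackets (simpleLetters S α d) u)
          (degree p + degree q) :=
      Submodule.span_mono (Set.image_mono fun u hu => ⟨Or.inr hu.1, hu.2⟩)
    refine lie_mem_of_mem_span ?_ (ihp (by omega)) (ihq (by omega))
    rintro _ ⟨u, ⟨hu, hud⟩, rfl⟩ _ ⟨v, ⟨hv, hvd⟩, rfl⟩
    -- Homogeneity pays off here: the constituents have the exact degrees of `p` and `q`, so their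
    -- bracket stays within `d`.
    rw [← hud, ← hvd] at hd hle ⊢
    rcases hu with rfl | hu <;> rcases hv with rfl | hv
    · rw [lie_self]
      exact zero_mem _
    · exact hle (lie_letter_mem_homogeneousSpan hv hd)
    · rw [← lie_skew, add_comm]
      rw [add_comm] at hd hle
      exact neg_mem (hle (lie_letter_mem_homogeneousSpan hu hd))
    · exact hle (mem_homogeneousSpan (hu.mul hv) (degree_mul _ _))

end Elimination

/-! ### The left-greedy brackets span. -/

section Spanning

variable {A : Type*} [LinearOrder A]

/-- Keeps every letter a Lyndon word during elimination, so that an eliminated letter is itself one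
of the required brackets. -/
theorem isSuffixMinimal_simpleBracket {α χ : FreeMagma A} (hα : IsSuffixMinimal (word α))
    (hχ : IsSuffixMinimal (word χ)) (h : word α < word χ) (n : ℕ) :
    IsSuffixMinimal (word (simpleBracket α n χ)) ∧ word α < word (simpleBracket α n χ) := by
  induction n with
  | zero => exact ⟨hχ, h⟩
  | succ n ih =>
    rw [word_simpleBracket_succ]
    exact ⟨hα.append ih.1 ih.2, List.lt_append_of_ne_nil (word_ne_nil _)⟩

/-- The left-greedy bracketings of the Lyndon-Shirshov words formed from the letters in `S`. -/
def lyndonBrackets (S : Set (FreeMagma A)) : Set (FreeMagma A) :=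
  {t | ∃ l : List (FreeMagma A), (∀ x ∈ l, x ∈ S) ∧ IsLyndonShirshov (l.flatMap word) ∧
    bracketWord l = some t}

/-- Spell out the simple letters over `S`. If the result starts with `α`, its first partition step
restores the given word of simple letters; otherwise that word contains no `α` and is unchanged. -/
theorem lyndonBrackets_simpleLetters_subset {S : Set (FreeMagma A)} (hS : PrefixFree S)
    {α : FreeMagma A} (hα : α ∈ S) (hmin : ∀ χ ∈ S, word α ≤ word χ) (d : ℕ) :
    lyndonBrackets (simpleLetters S α d) ⊆ lyndonBrackets S := by
  rintro t ⟨l, hlS, hl, ht⟩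
  obtain ⟨p, hp, rfl⟩ : ∃ p : List (ℕ × FreeMagma A), (∀ q ∈ p, q.2 ∈ S ∧ q.2 ≠ α) ∧
      l = p.map fun q => simpleBracket α q.1 q.2 := by
    clear hl ht
    induction l with
    | nil => exact ⟨[], by simp, rfl⟩
    | cons x l ih =>
      obtain ⟨p, hp, rfl⟩ := ih fun y hy => hlS y (by simp [hy])
      obtain ⟨-, n, χ, hχ, hne, rfl⟩ := hlS x (by simp)
      refine ⟨(n, χ) :: p, fun q hq => ?_, rfl⟩
      rcases List.mem_cons.1 hq with rfl | hq
      exacts [⟨hχ, hne⟩, hp q hq]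
  have hw : ∀ q ∈ p, ¬ word α <+: word q.2 := fun q hq h =>
    (hp q hq).2 (hS α hα q.2 (hp q hq).1 h).symm
  refine ⟨ofPartition α p, fun x hx => ?_, ?_, ?_⟩
  · obtain ⟨q, hq, hx⟩ := List.mem_flatMap.1 hx
    rcases List.mem_append.1 hx with hx | hx
    · rwa [List.eq_of_mem_replicate hx]
    · rw [List.mem_singleton.1 hx]
      exact (hp q hq).1
  · rwa [flatMap_word_ofPartition]
  · rw [← ht]
    match p, hp, hw, hl with
    | [], _, _, _ => rfl
    | (n + 1, χ) :: p, _, hw, _ =>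
      exact bracketWord_ofPartition α χ n p fun q hq h => hw q hq (h ▸ List.prefix_rfl)
    | (0, χ) :: p, hp, hw, hl =>
      have hχ := hp (0, χ) (by simp)
      -- A later factor with a copy of `α` would give a rotation starting with `α`, smaller than the
      -- word, which starts with `χ`.
      have h0 : ∀ q ∈ p, q.1 = 0 := by
        intro q hq
        by_contra hn
        obtain ⟨m, hm⟩ := Nat.exists_eq_succ_of_ne_zero hn
        obtain ⟨p₁, p₂, rfl⟩ := List.append_of_mem hq
        have hlt : word α < word χ := lt_of_le_of_ne (hmin χ hχ.1) fun h =>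
          hw (0, χ) (by simp) (h ▸ List.prefix_rfl)
        have e : (((0, χ) :: (p₁ ++ q :: p₂)).map fun q => simpleBracket α q.1 q.2) =
            (((0, χ) :: p₁).map fun q => simpleBracket α q.1 q.2) ++
              ((q :: p₂).map fun q => simpleBracket α q.1 q.2) := by simp
        rw [e, List.flatMap_append] at hl
        have h1 := hl.append_lt_append_swap (flatMap_word_ne_nil (by simp))
          (flatMap_word_ne_nil (by simp))
        simp only [List.map_cons, List.flatMap_cons, hm, Nat.succ_eq_add_one,
          word_simpleBracket_succ, simpleBracket_zero, List.append_assoc] at h1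
        exact lt_asymm h1 (List.append_lt_append_of_not_prefix hlt (hw (0, χ) (by simp)) _ _)
      have h2 : ∀ p : List (ℕ × FreeMagma A), (∀ q ∈ p, q.1 = 0) →
          ofPartition α p = p.map fun q => simpleBracket α q.1 q.2 := by
        intro p h
        induction p with
        | nil => rfl
        | cons q p ih =>
          obtain ⟨n, ψ⟩ := q
          obtain rfl : n = 0 := h (n, ψ) (by simp)
          rw [ofPartition_cons_zero, ih fun q hq => h q (by simp [hq])]
          rfl
      rw [h2]
      intro q hq
      rcases List.mem_cons.1 hq with rfl | hq
      exacts [rfl, h0 q hq]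

variable (K : Type*) [Field K]

/-- Induction on the multiset of letters: eliminating the least letter removes it and adds finitely
many letters of larger degree, bounded by `d`. The empty alphabet has no brackets. -/
theorem toFreeLie_mem_span_lyndonBrackets (d : ℕ) (B : Finset (FreeMagma A))
    (hdeg : ∀ t ∈ B, degree t ≤ d) (hpre : PrefixFree (B : Set (FreeMagma A)))
    (hmin : ∀ t ∈ B, IsSuffixMinimal (word t)) {t : FreeMagma A}
    (ht : Brackets (B : Set (FreeMagma A)) t) (htd : degree t ≤ d) :
    toFreeLie K t ∈
      Submodule.span K (toFreeLie K '' lyndonBrackets (B : Set (FreeMagma A))) := by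
  classical
  induction hM : B.val using (wellFounded_higherDegree (A := A) d).cutExpand.induction
    generalizing B t with
  | _ M ih =>
  subst hM
  rcases B.eq_empty_or_nonempty with rfl | hne
  · exfalso
    clear htd
    induction ht with
    | of h => simp at h
    | mul _ _ h _ => exact h
  obtain ⟨α, hα, hαmin⟩ := B.exists_min_image word hne
  set C : Set (FreeMagma A) := simpleLetters (B : Set (FreeMagma A)) α d with hC
  have hfin : C.Finite := simpleLetters_finite B.finite_toSet α d
  have hsub : B.erase α ⊆ hfin.toFinset := fun χ hχ => by
    rw [Finset.mem_erase] at hχ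
    exact hfin.mem_toFinset.2 ⟨hdeg χ hχ.2, 0, χ, hχ.2, hχ.1, rfl⟩
  have hlt : ∀ χ ∈ B, χ ≠ α → word α < word χ := fun χ hχ hne =>
    lt_of_le_of_ne (hαmin χ hχ) fun h => hne (hpre α hα χ hχ (h ▸ List.prefix_rfl)).symm
  have hcut : Relation.CutExpand (HigherDegree d) hfin.toFinset.val B.val := by
    refine ⟨(hfin.toFinset \ B.erase α).val, α, fun t ht => ?_, ?_⟩
    · obtain ⟨h1, h2⟩ := Finset.mem_sdiff.1 (show t ∈ hfin.toFinset \ B.erase α from ht)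
      obtain ⟨hd, n, χ, hχ, hne, rfl⟩ := hfin.mem_toFinset.1 h1
      refine ⟨?_, hd⟩
      cases n with
      -- A new letter with `n = 0` is an old one, so the added letters all have `n ≥ 1` and degree
      -- above that of `α`.
      | zero => exact absurd (Finset.mem_erase.2 ⟨hne, hχ⟩) h2
      | succ n =>
        rw [simpleBracket_succ, degree_mul]
        have := degree_pos (simpleBracket α n χ)
        omega
    · have h1 : B.val = (B.erase α).val + {α} := by
        rw [Finset.erase_val, Multiset.add_comm, Multiset.singleton_add,
          Multiset.cons_erase (show α ∈ B.val from hα)]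
      have h2 : hfin.toFinset.val = (B.erase α).val + (hfin.toFinset \ B.erase α).val := by
        rw [Finset.sdiff_val, add_tsub_cancel_of_le (Finset.val_le_iff.2 hsub)]
      rw [h1, h2, add_right_comm]
  have hC' : (hfin.toFinset : Set (FreeMagma A)) = C := hfin.coe_toFinset
  have hspan : ∀ s, Brackets C s → degree s ≤ d →
      toFreeLie K s ∈ Submodule.span K (toFreeLie K '' lyndonBrackets C) := by
    intro s hs hsd
    have := ih _ hcut hfin.toFinset (fun t ht => (hfin.mem_toFinset.1 ht).1) ?_ ?_
      (t := s) (by rwa [hC']) hsd rfl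
    · rwa [hC'] at this
    · rw [hC']
      exact hpre.simpleBracket hα fun t ht => ht.2
    · intro t ht
      obtain ⟨-, n, χ, hχ, hne, rfl⟩ := hfin.mem_toFinset.1 ht
      exact (isSuffixMinimal_simpleBracket (hmin α hα) (hmin χ hχ) (hlt χ hχ hne) n).1
  refine Submodule.span_le.2 ?_ (mem_homogeneousSpan_simpleLetters (α := α) ht htd)
  rintro _ ⟨u, ⟨hu, hud⟩, rfl⟩
  rcases hu with rfl | hu
  · refine Submodule.subset_span ⟨u, ⟨[u], by simpa using hα, ?_, by rw [bracketWord]⟩, rfl⟩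
    simpa using (hmin u hα).isLyndonShirshov
  · exact Submodule.span_mono
      (Set.image_mono (lyndonBrackets_simpleLetters_subset hpre hα hαmin d))
      (hspan u hu (hud.trans_le htd))

/-- Reduces an arbitrary alphabet to the finitely many letters occurring in `t`, with its degree as
the bound. -/
theorem toFreeLie_mem_span_leftGreedy (t : FreeMagma A) :
    toFreeLie K t ∈ Submodule.span K
      (toFreeLie K '' {s | ∃ w : List A, IsLyndonShirshov w ∧ leftGreedy w = some s}) := by
  classical
  set B : Finset (FreeMagma A) := (word t).toFinset.image FreeMagma.of with hB
  have hBmem : ∀ s ∈ B, ∃ a, FreeMagma.of a = s := fun s hs => by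
    obtain ⟨a, -, rfl⟩ := Finset.mem_image.1 hs
    exact ⟨a, rfl⟩
  have ht : Brackets (B : Set (FreeMagma A)) t := by
    have := brackets_range_of t
    rwa [hB, Finset.coe_image, List.coe_toFinset]
  refine Submodule.span_mono (Set.image_mono ?_)
    (toFreeLie_mem_span_lyndonBrackets K (degree t) B ?_ ?_ ?_ ht le_rfl)
  · rintro s ⟨l, hl, hlw, hs⟩
    obtain ⟨w, rfl⟩ : ∃ w : List A, w.map FreeMagma.of = l := by
      clear hlw hs
      induction l with
      | nil => exact ⟨[], rfl⟩
      | cons x l ih =>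
        obtain ⟨w, rfl⟩ := ih fun y hy => hl y (by simp [hy])
        obtain ⟨a, rfl⟩ := hBmem x (hl x (by simp))
        exact ⟨a :: w, rfl⟩
    refine ⟨w, ?_, hs⟩
    rwa [flatMap_word_map_of] at hlw
  · intro s hs
    obtain ⟨a, rfl⟩ := hBmem s hs
    exact degree_pos t
  · intro x hx y hy hxy
    obtain ⟨a, rfl⟩ := hBmem x hx
    obtain ⟨b, rfl⟩ := hBmem y hy
    have : a = b := by simpa [word] using hxy
    rw [this]
  · intro s hs
    obtain ⟨a, rfl⟩ := hBmem s hs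
    exact IsSuffixMinimal.singleton a

end Spanning

/-! ### Bracket expressions span the free Lie algebra. -/

section Generation

variable (K : Type*) [Field K] (A : Type*)

/-- The span is a Lie subalgebra containing the generators; by the universal property the identity
factors through it. -/
theorem span_range_toFreeLie :
    Submodule.span K (Set.range (toFreeLie K : FreeMagma A → FreeLieAlgebra K A)) = ⊤ := by
  let N : LieSubalgebra K (FreeLieAlgebra K A) :=
    { Submodule.span K (Set.range (toFreeLie K : FreeMagma A → FreeLieAlgebra K A)) with
      lie_mem' := fun {x y} hx hy => by
        refine lie_mem_of_mem_span ?_ hx hy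
        rintro _ ⟨s, rfl⟩ _ ⟨t, rfl⟩
        exact Submodule.subset_span ⟨FreeMagma.mul s t, rfl⟩ }
  let f : FreeLieAlgebra K A →ₗ⁅K⁆ N :=
    FreeLieAlgebra.lift K fun a => ⟨FreeLieAlgebra.of K a,
      Submodule.subset_span ⟨FreeMagma.of a, rfl⟩⟩
  have hf : N.incl.comp f = LieHom.id := by
    ext a
    simp [f]
  refine eq_top_iff.2 fun x _ => ?_
  have := LieHom.congr_fun hf x
  simp only [LieHom.comp_apply, LieHom.id_apply, LieSubalgebra.coe_incl] at this
  rw [← this]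
  exact (f x).2

end Generation

end LeftGreedy

theorem mainTheorem1 (K : Type*) [Field K] (A : Type*) [LinearOrder A] :
    ∃ b : Module.Basis {w : List A // IsLyndonShirshov w} K (FreeLieAlgebra K A),
      ∀ w : {w : List A // IsLyndonShirshov w},
        ∃ t : FreeMagma A, LeftGreedy.leftGreedy w.1 = some t ∧ b w = LeftGreedy.toFreeLie K t := by
  have h : ∀ w : {w : List A // IsLyndonShirshov w}, ∃ t, LeftGreedy.leftGreedy w.1 = some t ∧
      LeftGreedy.HasLeadingWord K (LeftGreedy.toPolynomial K (LeftGreedy.toFreeLie K t)) w.1 := by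
    intro w
    obtain ⟨t, ht, hw, hlead⟩ := LeftGreedy.exists_leftGreedy_eq_some
      (fun t => LeftGreedy.HasLeadingWord K
        (LeftGreedy.toPolynomial K (LeftGreedy.toFreeLie K t)) (LeftGreedy.word t))
      (LeftGreedy.hasLeadingWord_of K)
      (fun α χ n hα hχ hlt hp => LeftGreedy.hasLeadingWord_simpleBracket n hα hχ hlt hp) w.2
    rw [hw] at hlead
    exact ⟨t, ht, hlead⟩
  choose t ht hlead using h
  have hli : LinearIndependent K fun w => LeftGreedy.toFreeLie K (t w) :=
    LeftGreedy.linearIndependent_of_hasLeadingWord_toPolynomial _ hlead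
  have hsp : ⊤ ≤ Submodule.span K (Set.range fun w => LeftGreedy.toFreeLie K (t w)) := by
    rw [← LeftGreedy.span_range_toFreeLie K A, Submodule.span_le]
    rintro _ ⟨s, rfl⟩
    refine Submodule.span_mono ?_ (LeftGreedy.toFreeLie_mem_span_leftGreedy K s)
    rintro _ ⟨u, ⟨w, hw, hu⟩, rfl⟩
    refine ⟨⟨w, hw⟩, ?_⟩
    rw [ht ⟨w, hw⟩, Option.some.injEq] at hu
    exact congrArg _ hu
  exact ⟨Module.Basis.mk hli hsp, fun w => ⟨t w, ht w, Module.Basis.mk_apply hli hsp w⟩⟩
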